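/- Call $S\subseteq\mathbb{R}^d$ tropically convex if for all $x,y\in S$ and $\lambda,\mu\in\mathbb{R}$ the point $(\min(\lambda+x_i,\mu+y_i))_{i=1}^d$ lies in $S$; the tropical convex hull of a set is the smallest tropically convex set containing it. The Barvinok rank of a real $d\times n$ matrix is the smallest number of points in $\mathbb{R}^d$ whose tropical convex hull contains all columns of the matrix. For positive integers $d,n$ let $B_{d,n}\subseteq\mathbb{R}^{dn}$, with the subspace topology, be the set of real $d\times n$ matrices $M$ of Barvinok rank $2$ such that (i) the first row of $M$ is zero, (ii) the smallest entry in every row of $M$ is zero, and (iii) $M$, as a point of $\mathbb{R}^{dn}$, lies on the unit sphere. (These are normalized representatives of the matrices of Barvinok rank $2$ modulo adding constants to rows and columns and multiplying by positive scalars.) Theorem. For all positive integers $d$ and $n$, the space $B_{d,n}$ is homeomorphic to $(S^{d-2}\times S^{n-2})/\mathbb{Z}_2$, the quotient of the product of two spheres under the involution that sends each point to its antipode simultaneously in both components, $(x,y)\mapsto(-x,-y)$. Here $S^{k}$ is the unit sphere in $\mathbb{R}^{k+1}$, and $S^{-1}=\emptyset$. -/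

import Mathlib

/-- A set `S ⊆ ℝ^d` is tropically convex if `λ ⊙ x ⊕ μ ⊙ y ∈ S` for all `x, y ∈ S` and all real
`λ, μ`, where `a ⊙ b = a + b` and `a ⊕ b = min a b` (coordinatewise). -/
def TropicallyConvex {d : ℕ} (S : Set (Fin d → ℝ)) : Prop :=
  ∀ x ∈ S, ∀ y ∈ S, ∀ l m : ℝ, (fun i => min (l + x i) (m + y i)) ∈ S

/-- The tropical convex hull: the smallest tropically convex set containing `S`. -/
def tconv {d : ℕ} (S : Set (Fin d → ℝ)) : Set (Fin d → ℝ) :=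
  ⋂₀ {T | TropicallyConvex T ∧ S ⊆ T}

/-- The Barvinok rank of a real `d × n` matrix: the smallest number of points of `ℝ^d` whose
tropical convex hull contains all columns of the matrix. -/
noncomputable def barvinokRank {d n : ℕ} (M : Matrix (Fin d) (Fin n) ℝ) : ℕ :=
  sInf {k | ∃ X : Finset (Fin d → ℝ), X.card = k ∧
    ∀ j : Fin n, (fun i => M i j) ∈ tconv (X : Set (Fin d → ℝ))}

/-- The space `B_{d,n}` of normalized representatives of `d × n` matrices of Barvinok rank `2`:
the first row is zero, the smallest entry of every row is zero, and the matrix lies on the unit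
sphere of `ℝ^{dn}`. It carries the subspace topology of the space of matrices. -/
def barvinokSpace (d n : ℕ) : Set (Matrix (Fin d) (Fin n) ℝ) :=
  {M | barvinokRank M = 2 ∧
    (∀ i : Fin d, (i : ℕ) = 0 → ∀ j, M i j = 0) ∧
    (∀ i : Fin d, IsLeast (Set.range fun j => M i j) 0) ∧
    ∑ i, ∑ j, M i j ^ 2 = 1}

/-- The unit sphere of Euclidean space `ℝ^k`, that is, the sphere `S^{k-1}`
(empty for `k = 0`). -/
abbrev unitSphere (k : ℕ) : Type :=
  Metric.sphere (0 : EuclideanSpace ℝ (Fin k)) 1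

/-- The orbit relation of the involution `(x, y) ↦ (-x, -y)` on a product of two spheres. -/
def antipodalSetoid (k m : ℕ) : Setoid (unitSphere k × unitSphere m) where
  r p q := q = p ∨ q = (-p.1, -p.2)
  iseqv :=
    { refl := fun _ => Or.inl rfl
      symm := by
        rintro p q (rfl | rfl)
        · exact Or.inl rfl
        · exact Or.inr (by simp)
      trans := by
        rintro p q r (rfl | rfl) (rfl | rfl)
        · exact Or.inl rfl
        · exact Or.inr rfl
        · exact Or.inr rfl
        · exact Or.inl (by simp) }

/-!
A matrix of Barvinok rank at most `2` has columns in a tropical segment, so its entries are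
`min (a j + p i) (b j + q i) = p i + b j + min (q i - p i) (a j - b j)`. Up to row and column
constants it is therefore a matrix of minima `min (u i) (v j)`. Clamping `u` and `v` to the
intersection of their ranges changes this matrix only by row and column constants
(`min_eq_min_clamp_add`), and rescaling then makes `0` and `1` the extreme coordinates of both
vectors (`exists_spanningVectors`).

Up to row and column constants, a matrix is determined by its cross differences
`A i j + A i' j' - A i j' - A i' j`, and a normalized matrix is determined by its cross differences
up to a positive factor (`IsNormalized.eq_of_crossDiff`). For a matrix of minima the cross
difference is, up to sign, the length of the intersection of the interval between `u i` and `u i'`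
with the interval between `v j` and `v j'`. When `u` and `v` have extreme coordinates `0` and `1`,
its largest value is `1`, and the cross differences recover `(u, v)` up to the simultaneous
replacement of `u` by `1 - u` and `v` by `1 - v` (`eq_or_eq_one_sub_of_crossDiff`).

The vectors in `ℝ^{k+1}` with smallest coordinate `0` and largest coordinate `1` represent the unit
sphere of the seminorm `max - min`, a norm on the quotient of `ℝ^{k+1}` by the constants. Radial
projection identifies them with the Euclidean sphere in `ℝ^k` (`sphereVector`), and `u ↦ 1 - u`
becomes the antipodal map. So `sphereMatrix` is a continuous surjection from the product of spheres
onto `barvinokSpace` whose fibres are the orbits of the involution, and compactness makes the induced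
bijection a homeomorphism.
-/

/-- The alternating sum of the entries of `A` at the corners of the rectangle with rows `i, i'` and
columns `j, j'`. These sums determine `A` up to adding constants to its rows and columns. -/
def crossDiff {d n : ℕ} (A : Matrix (Fin d) (Fin n) ℝ) (i i' : Fin d) (j j' : Fin n) : ℝ :=
  A i j + A i' j' - A i j' - A i' j

/-- The conditions on a member of `barvinokSpace d n` other than the one on its Barvinok rank. -/
def IsNormalized {d n : ℕ} (M : Matrix (Fin d) (Fin n) ℝ) : Prop :=
  (∀ i : Fin d, (i : ℕ) = 0 → ∀ j, M i j = 0) ∧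
    (∀ i : Fin d, IsLeast (Set.range fun j => M i j) 0) ∧
    ∑ i, ∑ j, M i j ^ 2 = 1

/-- The matrix with entries `min (u i) (v j)`. -/
def minMatrix {d n : ℕ} (u : Fin d → ℝ) (v : Fin n → ℝ) : Matrix (Fin d) (Fin n) ℝ :=
  fun i j => min (u i) (v j)

/-- The vectors with smallest coordinate `0` and largest coordinate `1`. -/
def spanningVectors (d : ℕ) : Set (Fin d → ℝ) :=
  {u | IsLeast (Set.range u) 0 ∧ IsGreatest (Set.range u) 1}

/-! ### Matrices up to row and column constants -/

theorem IsNormalized.eq_of_crossDiff {k n : ℕ} {M M' : Matrix (Fin (k + 1)) (Fin n) ℝ}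
    (hM : IsNormalized M) (hM' : IsNormalized M') {c : ℝ} (hc : 0 < c)
    (h : ∀ i i' j j', crossDiff M i i' j j' = c * crossDiff M' i i' j j') : M = M' := by
  obtain ⟨h0, hl, hs⟩ := hM
  obtain ⟨h0', hl', hs'⟩ := hM'
  have key : ∀ i j j', M i j - M i j' = c * (M' i j - M' i j') := by
    intro i j j'
    have := h i 0 j j'
    simpa only [crossDiff, h0 0 rfl, h0' 0 rfl, add_zero, sub_zero] using this
  have hcM : ∀ i j, M i j = c * M' i j := by
    intro i j
    obtain ⟨j₁, hj₁⟩ := (hl i).1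
    obtain ⟨j₂, hj₂⟩ := (hl' i).1
    have h₁ : 0 ≤ M' i j₁ := (hl' i).2 ⟨j₁, rfl⟩
    have h₂ : 0 ≤ M i j₂ := (hl i).2 ⟨j₂, rfl⟩
    have e₁ := key i j j₁
    have e₂ := key i j j₂
    simp only at hj₁ hj₂
    rw [hj₁] at e₁
    rw [hj₂] at e₂
    nlinarith [mul_nonneg hc.le h₁]
  have hc1 : c = 1 := by
    simp only [hcM, mul_pow, ← Finset.mul_sum, hs'] at hs
    nlinarith
  ext i j
  rw [hcM, hc1, one_mul]

/-- A normalized matrix is not the sum of a row constant and a column constant. -/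
theorem IsNormalized.exists_crossDiff_ne_zero {k n : ℕ} {M : Matrix (Fin (k + 1)) (Fin n) ℝ}
    (hM : IsNormalized M) : ∃ i i' j j', crossDiff M i i' j j' ≠ 0 := by
  by_contra! h
  obtain ⟨h0, hl, hs⟩ := hM
  have hz : ∀ i j, M i j = 0 := by
    intro i j
    obtain ⟨j₁, hj₁⟩ := (hl i).1
    have e := h i 0 j j₁
    simp only [crossDiff, h0 0 rfl] at e hj₁
    linarith
  simp [hz] at hs

/-- Subtract the first row from every row, and then the smallest entry of each row from that row. -/
def rowNormal {k m : ℕ} (A : Matrix (Fin (k + 1)) (Fin (m + 1)) ℝ) :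
    Matrix (Fin (k + 1)) (Fin (m + 1)) ℝ :=
  fun i j => A i j - A 0 j - Finset.univ.inf' Finset.univ_nonempty fun j' => A i j' - A 0 j'

/-- The Frobenius norm of `rowNormal A`. -/
noncomputable def rowNormalNorm {k m : ℕ} (A : Matrix (Fin (k + 1)) (Fin (m + 1)) ℝ) : ℝ :=
  √(∑ i, ∑ j, rowNormal A i j ^ 2)

/-- The normalized representative of the class of `A` modulo row constants, column constants and
positive scalars; it is the zero matrix if `A` is a sum of a row constant and a column constant. -/
noncomputable def normalForm {k m : ℕ} (A : Matrix (Fin (k + 1)) (Fin (m + 1)) ℝ) :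
    Matrix (Fin (k + 1)) (Fin (m + 1)) ℝ :=
  fun i j => (rowNormalNorm A)⁻¹ * rowNormal A i j

section NormalForm

variable {k m : ℕ} (A : Matrix (Fin (k + 1)) (Fin (m + 1)) ℝ)

theorem crossDiff_rowNormal (i i' j j') :
    crossDiff (rowNormal A) i i' j j' = crossDiff A i i' j j' := by
  simp only [crossDiff, rowNormal]
  ring

theorem crossDiff_normalForm (i i' j j') :
    crossDiff (normalForm A) i i' j j' = (rowNormalNorm A)⁻¹ * crossDiff A i i' j j' := by
  rw [← crossDiff_rowNormal A]
  simp only [crossDiff, normalForm]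
  ring

variable {A}

theorem rowNormalNorm_pos (h : ∃ i i' j j', crossDiff A i i' j j' ≠ 0) :
    0 < rowNormalNorm A := by
  refine Real.sqrt_pos.2 (lt_of_le_of_ne (by positivity) fun h0 => ?_)
  have hz : ∀ i j, rowNormal A i j = 0 := by
    intro i j
    have h1 := (Finset.sum_eq_zero_iff_of_nonneg (fun i _ => by positivity)).1 h0.symm i
      (Finset.mem_univ i)
    have h2 := (Finset.sum_eq_zero_iff_of_nonneg (fun j _ => by positivity)).1 h1 j
      (Finset.mem_univ j)
    exact pow_eq_zero_iff two_ne_zero |>.1 h2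
  obtain ⟨i, i', j, j', hne⟩ := h
  rw [← crossDiff_rowNormal] at hne
  simp [crossDiff, hz] at hne

theorem isNormalized_normalForm (h : ∃ i i' j j', crossDiff A i i' j j' ≠ 0) :
    IsNormalized (normalForm A) := by
  have hpos := rowNormalNorm_pos h
  refine ⟨fun i hi j => ?_, fun i => ⟨?_, ?_⟩, ?_⟩
  · obtain rfl : i = 0 := Fin.ext hi
    simp [normalForm, rowNormal]
  · obtain ⟨j, -, hj⟩ := Finset.exists_mem_eq_inf' (s := (Finset.univ : Finset (Fin (m + 1))))
      Finset.univ_nonempty fun j' => A i j' - A 0 j'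
    exact ⟨j, by simp [normalForm, rowNormal, hj]⟩
  · rintro _ ⟨j, rfl⟩
    have := Finset.inf'_le (fun j' => A i j' - A 0 j') (Finset.mem_univ j)
    exact mul_nonneg (inv_nonneg.2 hpos.le) (sub_nonneg.2 this)
  · simp only [normalForm, mul_pow, ← Finset.mul_sum]
    have hsq : rowNormalNorm A ^ 2 = ∑ i, ∑ j, rowNormal A i j ^ 2 :=
      Real.sq_sqrt (by positivity)
    rw [← hsq, ← mul_pow, inv_mul_cancel₀ hpos.ne', one_pow]

end NormalForm

theorem continuous_rowNormal {k m : ℕ} : Continuous (rowNormal (k := k) (m := m)) := by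
  have he : ∀ i j, Continuous fun A : Matrix (Fin (k + 1)) (Fin (m + 1)) ℝ => A i j :=
    fun i j => continuous_id.matrix_elem i j
  refine continuous_matrix fun i j => ((he i j).sub (he 0 j)).sub ?_
  exact Continuous.finset_inf'_apply _ fun j' _ => (he i j').sub (he 0 j')

theorem continuous_rowNormalNorm {k m : ℕ} : Continuous (rowNormalNorm (k := k) (m := m)) := by
  refine Real.continuous_sqrt.comp (continuous_finsetSum _ fun i _ =>
    continuous_finsetSum _ fun j _ => ?_)
  exact (continuous_rowNormal.matrix_elem i j).pow 2

/-! ### Matrices of Barvinok rank two -/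

theorem mem_tconv_pair {d : ℕ} {p q z : Fin d → ℝ} :
    z ∈ tconv {p, q} ↔ ∃ l m : ℝ, ∀ i, z i = min (l + p i) (m + q i) := by
  constructor
  · intro hz
    refine hz {z | ∃ l m : ℝ, ∀ i, z i = min (l + p i) (m + q i)} ⟨?_, ?_⟩
    · rintro x ⟨l₁, m₁, hx⟩ y ⟨l₂, m₂, hy⟩ l m
      refine ⟨min (l + l₁) (m + l₂), min (l + m₁) (m + m₂), fun i => ?_⟩
      simp only [hx, hy, ← min_add_add_left, ← min_add_add_right, add_assoc]
      exact min_min_min_comm _ _ _ _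
    · -- a coefficient this large makes the other generator irrelevant to the minimum
      have hb : ∀ i, |p i - q i| ≤ ∑ i, |p i - q i| := fun i =>
        Finset.single_le_sum (f := fun i => |p i - q i|) (fun _ _ => abs_nonneg _)
          (Finset.mem_univ i)
      rintro x (rfl | rfl)
      · refine ⟨0, ∑ i, |x i - q i|, fun i => ?_⟩
        rw [zero_add, min_eq_left]
        linarith [hb i, le_abs_self (x i - q i)]
      · refine ⟨∑ i, |p i - x i|, 0, fun i => ?_⟩
        rw [zero_add, min_eq_right]
        linarith [hb i, neg_le_abs (p i - x i)]
  · rintro ⟨l, m, hz⟩ T ⟨hT, hs⟩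
    have := hT p (hs (by simp)) q (hs (by simp)) l m
    rwa [← funext hz] at this

/-- With two equal generators the matrix is a sum of a row constant and a column constant. -/
theorem crossDiff_eq_zero_of_min {d n : ℕ} {M : Matrix (Fin d) (Fin n) ℝ} {p : Fin d → ℝ}
    {a b : Fin n → ℝ} (h : ∀ i j, M i j = min (a j + p i) (b j + p i)) (i i' j j') :
    crossDiff M i i' j j' = 0 := by
  simp only [crossDiff, h, min_add_add_right]
  ring

theorem IsNormalized.barvinokRank_eq_two_iff {k n : ℕ} (hn : 0 < n)
    {M : Matrix (Fin (k + 1)) (Fin n) ℝ} (hM : IsNormalized M) :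
    barvinokRank M = 2 ↔ ∃ (p q : Fin (k + 1) → ℝ) (a b : Fin n → ℝ),
      ∀ i j, M i j = min (a j + p i) (b j + q i) := by
  obtain ⟨i, i', j, j', hne⟩ := hM.exists_crossDiff_ne_zero
  constructor
  · intro h
    have hmem := Nat.sInf_mem (Nat.nonempty_of_pos_sInf (h.symm ▸ two_pos : 0 < barvinokRank M))
    obtain ⟨X, hX, hcol⟩ := hmem
    obtain ⟨p, q, -, rfl⟩ := Finset.card_eq_two.1 (hX.trans h)
    simp only [Finset.coe_insert, Finset.coe_singleton, mem_tconv_pair] at hcol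
    choose a b hab using hcol
    exact ⟨p, q, a, b, fun i j => hab j i⟩
  · rintro ⟨p, q, a, b, h⟩
    have hpq : p ≠ q := by
      rintro rfl
      exact hne (crossDiff_eq_zero_of_min h i i' j j')
    have h2 : ∃ X : Finset (Fin (k + 1) → ℝ), X.card = 2 ∧
        ∀ j : Fin n, (fun i => M i j) ∈ tconv (X : Set (Fin (k + 1) → ℝ)) := by
      classical
      refine ⟨{p, q}, Finset.card_pair hpq, fun j => ?_⟩
      simp only [Finset.coe_insert, Finset.coe_singleton, mem_tconv_pair]
      exact ⟨a j, b j, fun i => h i j⟩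
    refine le_antisymm (Nat.sInf_le h2) (le_csInf ⟨2, h2⟩ ?_)
    rintro c ⟨X, rfl, hcol⟩
    by_contra! hlt
    interval_cases hc : X.card
    · obtain rfl := Finset.card_eq_zero.1 hc
      have := hcol ⟨0, hn⟩ ∅ ⟨fun x hx => hx.elim, by simp⟩
      exact this
    · obtain ⟨x, rfl⟩ := Finset.card_eq_one.1 hc
      rw [Finset.coe_singleton, ← Set.pair_eq_singleton] at hcol
      simp only [mem_tconv_pair] at hcol
      choose a' b' hab using hcol
      exact hne (crossDiff_eq_zero_of_min (fun i j => hab j i) i i' j j')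

/-! ### Matrices of minima -/

theorem crossDiff_minMatrix_one_sub {d n : ℕ} (u : Fin d → ℝ) (v : Fin n → ℝ) (i i' j j') :
    crossDiff (minMatrix (1 - u) (1 - v)) i i' j j' = crossDiff (minMatrix u v) i i' j j' := by
  have h : ∀ a b : ℝ, min (1 - a) (1 - b) = 1 - a - b + min a b := by
    intro a b
    rcases le_total a b with h | h
    · rw [min_eq_right (by linarith), min_eq_left h]; ring
    · rw [min_eq_left (by linarith), min_eq_right h]; ring
  simp only [crossDiff, minMatrix, Pi.sub_apply, Pi.one_apply, h]
  ring

/-- The cross difference of a matrix of minima is, up to sign, the length of the intersection of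
the interval between `a, a'` with the interval between `b, b'`. -/
theorem min_crossDiff_le_one {a a' b b' : ℝ} (ha : a ∈ Set.Icc 0 1) (ha' : a' ∈ Set.Icc 0 1)
    (hb : b ∈ Set.Icc 0 1) (hb' : b' ∈ Set.Icc 0 1) :
    min a b + min a' b' - min a b' - min a' b ≤ 1 := by
  simp only [Set.mem_Icc] at *
  rcases le_total a b with h₁ | h₁ <;> rcases le_total a' b' with h₂ | h₂ <;>
    rcases le_total a b' with h₃ | h₃ <;> rcases le_total a' b with h₄ | h₄ <;>
    simp only [min_eq_left, min_eq_right, h₁, h₂, h₃, h₄] <;> linarith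

theorem eq_of_min_crossDiff_eq_one {a a' b b' : ℝ} (ha : a ∈ Set.Icc 0 1)
    (ha' : a' ∈ Set.Icc 0 1) (hb : b ∈ Set.Icc 0 1) (hb' : b' ∈ Set.Icc 0 1)
    (h : min a b + min a' b' - min a b' - min a' b = 1) :
    (a = 0 ∧ a' = 1 ∧ b = 0 ∧ b' = 1) ∨ (a = 1 ∧ a' = 0 ∧ b = 1 ∧ b' = 0) := by
  simp only [Set.mem_Icc] at *
  rcases le_total a b with h₁ | h₁ <;> rcases le_total a' b' with h₂ | h₂ <;>
    rcases le_total a b' with h₃ | h₃ <;> rcases le_total a' b with h₄ | h₄ <;>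
    simp only [min_eq_left, min_eq_right, h₁, h₂, h₃, h₄] at h <;>
    first
    | exact Or.inl ⟨by linarith, by linarith, by linarith, by linarith⟩
    | exact Or.inr ⟨by linarith, by linarith, by linarith, by linarith⟩

theorem mem_Icc_of_mem_spanningVectors {d : ℕ} {u : Fin d → ℝ} (hu : u ∈ spanningVectors d)
    (i : Fin d) : u i ∈ Set.Icc 0 1 :=
  ⟨hu.1.2 ⟨i, rfl⟩, hu.2.2 ⟨i, rfl⟩⟩

theorem crossDiff_minMatrix_le_one {d n : ℕ} {u : Fin d → ℝ} {v : Fin n → ℝ}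
    (hu : u ∈ spanningVectors d) (hv : v ∈ spanningVectors n) (i i' j j') :
    crossDiff (minMatrix u v) i i' j j' ≤ 1 :=
  min_crossDiff_le_one (mem_Icc_of_mem_spanningVectors hu i) (mem_Icc_of_mem_spanningVectors hu i')
    (mem_Icc_of_mem_spanningVectors hv j) (mem_Icc_of_mem_spanningVectors hv j')

theorem exists_crossDiff_minMatrix_eq_one {d n : ℕ} {u : Fin d → ℝ} {v : Fin n → ℝ}
    (hu : u ∈ spanningVectors d) (hv : v ∈ spanningVectors n) :
    ∃ i i' j j', (u i = 0 ∧ u i' = 1 ∧ v j = 0 ∧ v j' = 1) ∧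
      crossDiff (minMatrix u v) i i' j j' = 1 := by
  obtain ⟨⟨⟨i, hi⟩, -⟩, ⟨⟨i', hi'⟩, -⟩⟩ := hu
  obtain ⟨⟨⟨j, hj⟩, -⟩, ⟨⟨j', hj'⟩, -⟩⟩ := hv
  exact ⟨i, i', j, j', ⟨hi, hi', hj, hj'⟩, by simp [crossDiff, minMatrix, hi, hi', hj, hj']⟩

/-- The largest cross difference fixes the scalar, the position where it is attained decides between
the two alternatives, and the cross differences at that position along one side read off `u`
and `v`. -/
theorem eq_or_eq_one_sub_of_crossDiff {d n : ℕ} {u u' : Fin d → ℝ} {v v' : Fin n → ℝ}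
    (hu : u ∈ spanningVectors d) (hv : v ∈ spanningVectors n)
    (hu' : u' ∈ spanningVectors d) (hv' : v' ∈ spanningVectors n) {c : ℝ} (hc : 0 < c)
    (h : ∀ i i' j j',
      crossDiff (minMatrix u' v') i i' j j' = c * crossDiff (minMatrix u v) i i' j j') :
    (u' = u ∧ v' = v) ∨ (u' = 1 - u ∧ v' = 1 - v) := by
  obtain ⟨i₀, i₁, j₀, j₁, ⟨hi₀, hi₁, hj₀, hj₁⟩, h1⟩ := exists_crossDiff_minMatrix_eq_one hu hv
  have hc1 : c = 1 := by
    obtain ⟨i, i', j, j', -, h1'⟩ := exists_crossDiff_minMatrix_eq_one hu' hv'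
    have e := h i₀ i₁ j₀ j₁
    have e' := h i i' j j'
    have l := crossDiff_minMatrix_le_one hu' hv' i₀ i₁ j₀ j₁
    have l' := crossDiff_minMatrix_le_one hu hv i i' j j'
    rw [h1] at e
    rw [h1'] at e'
    nlinarith
  simp only [hc1, one_mul] at h
  have hru : ∀ i, 0 ≤ u i ∧ u i ≤ 1 := mem_Icc_of_mem_spanningVectors hu
  have hrv : ∀ i, 0 ≤ v i ∧ v i ≤ 1 := mem_Icc_of_mem_spanningVectors hv
  have hru' : ∀ i, 0 ≤ u' i ∧ u' i ≤ 1 := mem_Icc_of_mem_spanningVectors hu'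
  have hrv' : ∀ i, 0 ≤ v' i ∧ v' i ≤ 1 := mem_Icc_of_mem_spanningVectors hv'
  rcases eq_of_min_crossDiff_eq_one (hru' i₀) (hru' i₁) (hrv' j₀) (hrv' j₁)
    ((h i₀ i₁ j₀ j₁).trans h1) with ⟨e₁, e₂, e₃, e₄⟩ | ⟨e₁, e₂, e₃, e₄⟩
  · refine Or.inl ⟨funext fun i => ?_, funext fun j => ?_⟩
    · simpa [crossDiff, minMatrix, hi₀, hj₀, hj₁, e₁, e₃, e₄, hru i, hru' i] using h i₀ i j₀ j₁
    · simpa [crossDiff, minMatrix, hi₀, hi₁, hj₀, e₁, e₂, e₃, hrv j, hrv' j] using h i₀ i₁ j₀ j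
  · refine Or.inr ⟨funext fun i => ?_, funext fun j => ?_⟩
    · have := h i₀ i j₀ j₁
      simp [crossDiff, minMatrix, hi₀, hj₀, hj₁, e₁, e₃, e₄, hru i, hru' i] at this
      simp only [Pi.sub_apply, Pi.one_apply]
      linarith
    · have := h i₀ i₁ j₀ j
      simp [crossDiff, minMatrix, hi₀, hi₁, hj₀, e₁, e₂, e₃, hrv j, hrv' j] at this
      simp only [Pi.sub_apply, Pi.one_apply]
      linarith

/-- The hypotheses say that `min a b ≤ R` and `L ≤ max a b`; the two correction terms depend on one
of `a` and `b` each. -/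
theorem min_eq_min_clamp_add {a b L R : ℝ} (hLR : L ≤ R) (hL : L ≤ a ∨ L ≤ b)
    (hR : a ≤ R ∨ b ≤ R) :
    min a b = min (max L (min R a)) (max L (min R b)) + min (a - L) 0 + min (b - L) 0 := by
  rcases le_total a b with h | h <;> rcases le_total L a with h₁ | h₁ <;>
    rcases le_total L b with h₂ | h₂ <;> rcases le_total a R with h₃ | h₃ <;>
    rcases le_total b R with h₄ | h₄ <;> grind

theorem clamp_mem_spanningVectors {d : ℕ} {u : Fin d → ℝ} {L R : ℝ} (hLR : L < R) {i₀ i₁ : Fin d}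
    (h₀ : u i₀ ≤ L) (h₁ : R ≤ u i₁) :
    (fun i => (max L (min R (u i)) - L) / (R - L)) ∈ spanningVectors d := by
  have hpos : 0 < R - L := sub_pos.2 hLR
  refine ⟨⟨⟨i₀, ?_⟩, ?_⟩, ⟨⟨i₁, ?_⟩, ?_⟩⟩
  · simp [h₀]
  · rintro _ ⟨i, rfl⟩
    exact div_nonneg (sub_nonneg.2 (le_max_left _ _)) hpos.le
  · simp only [min_eq_left h₁, max_eq_right hLR.le]
    exact div_self hpos.ne'
  · rintro _ ⟨i, rfl⟩
    refine (div_le_one hpos).2 (sub_le_sub_right (max_le hLR.le (min_le_left _ _)) _)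

/-- Up to row constants, column constants and a scalar, a nontrivial matrix of minima is one of
spanning vectors: clamp both vectors to the intersection `[L, R]` of their ranges. -/
theorem exists_spanningVectors {d n : ℕ} (u : Fin d → ℝ) (v : Fin n → ℝ)
    (h : ∃ i i' j j', crossDiff (minMatrix u v) i i' j j' ≠ 0) :
    ∃ u' ∈ spanningVectors d, ∃ v' ∈ spanningVectors n, ∃ c : ℝ, 0 < c ∧ ∀ i i' j j',
      crossDiff (minMatrix u v) i i' j j' = c * crossDiff (minMatrix u' v') i i' j j' := by
  obtain ⟨i, i', j, j', hne⟩ := h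
  obtain ⟨i₀, hi₀⟩ : ∃ i₀, ∀ i, u i₀ ≤ u i := haveI : Nonempty (Fin d) := ⟨i⟩; Finite.exists_min u
  obtain ⟨i₁, hi₁⟩ : ∃ i₁, ∀ i, u i ≤ u i₁ := haveI : Nonempty (Fin d) := ⟨i⟩; Finite.exists_max u
  obtain ⟨j₀, hj₀⟩ : ∃ j₀, ∀ j, v j₀ ≤ v j := haveI : Nonempty (Fin n) := ⟨j⟩; Finite.exists_min v
  obtain ⟨j₁, hj₁⟩ : ∃ j₁, ∀ j, v j ≤ v j₁ := haveI : Nonempty (Fin n) := ⟨j⟩; Finite.exists_max v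
  have hlr : max (u i₀) (v j₀) < min (u i₁) (v j₁) := by
    by_contra! hle
    -- one of the vectors is constant, or one of them dominates the other in all coordinates
    have hcase : (∀ i j, u i ≤ v j) ∨ (∀ i j, v j ≤ u i) := by
      rcases le_max_iff.1 hle with hle | hle <;> rcases min_le_iff.1 hle with hle | hle
      · exact absurd (show crossDiff (minMatrix u v) i i' j j' = 0 by
          have hc : ∀ i, u i = u i₀ := fun i => le_antisymm ((hi₁ i).trans hle) (hi₀ i)
          simp [crossDiff, minMatrix, hc]) hne
      · exact Or.inr fun i j => (hj₁ j).trans (hle.trans (hi₀ i))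
      · exact Or.inl fun i j => (hi₁ i).trans (hle.trans (hj₀ j))
      · exact absurd (show crossDiff (minMatrix u v) i i' j j' = 0 by
          have hc : ∀ j, v j = v j₀ := fun j => le_antisymm ((hj₁ j).trans hle) (hj₀ j)
          simp [crossDiff, minMatrix, hc]) hne
    rcases hcase with hc | hc <;> exact hne (by simp [crossDiff, minMatrix, hc])
  have hL : ∀ i j, max (u i₀) (v j₀) ≤ u i ∨ max (u i₀) (v j₀) ≤ v j := by
    intro i j
    rcases le_total (u i₀) (v j₀) with hm | hm
    · exact Or.inr (by simpa [hm] using hj₀ j)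
    · exact Or.inl (by simpa [hm] using hi₀ i)
  have hR : ∀ i j, u i ≤ min (u i₁) (v j₁) ∨ v j ≤ min (u i₁) (v j₁) := by
    intro i j
    rcases le_total (u i₁) (v j₁) with hm | hm
    · exact Or.inl (by simpa [hm] using hi₁ i)
    · exact Or.inr (by simpa [hm] using hj₁ j)
  generalize hLdef : max (u i₀) (v j₀) = L at hlr hL
  generalize hRdef : min (u i₁) (v j₁) = R at hlr hR
  refine ⟨_, clamp_mem_spanningVectors hlr (hLdef ▸ le_max_left _ _ : u i₀ ≤ L)
    (hRdef ▸ min_le_left _ _ : R ≤ u i₁), _,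
    clamp_mem_spanningVectors hlr (hLdef ▸ le_max_right _ _ : v j₀ ≤ L)
    (hRdef ▸ min_le_right _ _ : R ≤ v j₁), R - L, sub_pos.2 hlr, fun i i' j j' => ?_⟩
  have hpos : 0 < R - L := sub_pos.2 hlr
  have hmul : ∀ a b : ℝ, (R - L) * min ((a - L) / (R - L)) ((b - L) / (R - L)) = min a b - L := by
    intro a b
    rw [mul_min_of_nonneg _ _ hpos.le, mul_div_cancel₀ _ hpos.ne', mul_div_cancel₀ _ hpos.ne',
      min_sub_sub_right]
  have hmin := fun i j => min_eq_min_clamp_add hlr.le (hL i j) (hR i j)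
  simp only [crossDiff, minMatrix, mul_sub, mul_add, hmul, hmin]
  ring

/-! ### Spheres as spaces of spanning vectors -/

/-- The increasing affine image of `z` with smallest coordinate `0` and largest coordinate `1`
(the zero vector if `z` is constant). -/
noncomputable def stretch {k : ℕ} (z : Fin (k + 1) → ℝ) : Fin (k + 1) → ℝ := fun i =>
  (z i - Finset.univ.inf' Finset.univ_nonempty z) /
    (Finset.univ.sup' Finset.univ_nonempty z - Finset.univ.inf' Finset.univ_nonempty z)

theorem inf'_lt_sup'_of_exists_ne {k : ℕ} {z : Fin (k + 1) → ℝ} (h : ∃ i, z i ≠ z 0) :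
    Finset.univ.inf' Finset.univ_nonempty z < Finset.univ.sup' Finset.univ_nonempty z := by
  obtain ⟨i, hi⟩ := h
  have h₁ := fun i => Finset.inf'_le z (Finset.mem_univ i)
  have h₂ := fun i => Finset.le_sup' z (Finset.mem_univ i)
  rcases lt_or_gt_of_ne hi with h | h
  · exact (h₁ i).trans_lt (h.trans_le (h₂ 0))
  · exact (h₁ 0).trans_lt (h.trans_le (h₂ i))

theorem stretch_spec {k : ℕ} {z : Fin (k + 1) → ℝ} (h : ∃ i, z i ≠ z 0) :
    stretch z ∈ spanningVectors (k + 1) ∧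
      ∃ s t : ℝ, 0 < s ∧ ∀ i, z i = s * stretch z i + t := by
  have hpos := sub_pos.2 (inf'_lt_sup'_of_exists_ne h)
  obtain ⟨i₀, -, hi₀⟩ := Finset.exists_mem_eq_inf' (s := (Finset.univ : Finset (Fin (k + 1))))
    Finset.univ_nonempty z
  obtain ⟨i₁, -, hi₁⟩ := Finset.exists_mem_eq_sup' (s := (Finset.univ : Finset (Fin (k + 1))))
    Finset.univ_nonempty z
  refine ⟨⟨⟨⟨i₀, ?_⟩, ?_⟩, ⟨⟨i₁, ?_⟩, ?_⟩⟩, _,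
    Finset.univ.inf' Finset.univ_nonempty z, hpos, fun i => ?_⟩
  · simp [stretch, hi₀]
  · rintro _ ⟨i, rfl⟩
    exact div_nonneg (sub_nonneg.2 (Finset.inf'_le z (Finset.mem_univ i))) hpos.le
  · rw [stretch, ← hi₁, div_self hpos.ne']
  · rintro _ ⟨i, rfl⟩
    exact (div_le_one hpos).2 (sub_le_sub_right (Finset.le_sup' z (Finset.mem_univ i)) _)
  · rw [stretch, mul_div_cancel₀ _ hpos.ne', sub_add_cancel]

theorem stretch_eq {k : ℕ} {z u : Fin (k + 1) → ℝ} (hu : u ∈ spanningVectors (k + 1)) {s t : ℝ}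
    (hs : 0 < s) (h : ∀ i, z i = s * u i + t) : stretch z = u := by
  obtain ⟨⟨⟨i₀, hi₀⟩, hl⟩, ⟨⟨i₁, hi₁⟩, hg⟩⟩ := hu
  have h₀ : Finset.univ.inf' Finset.univ_nonempty z = t := by
    refine le_antisymm ?_ (Finset.le_inf' _ _ fun i _ => ?_)
    · exact (Finset.inf'_le z (Finset.mem_univ i₀)).trans_eq (by simp [h, hi₀])
    · have : 0 ≤ u i := hl ⟨i, rfl⟩
      rw [h]
      nlinarith
  have h₁ : Finset.univ.sup' Finset.univ_nonempty z = s + t := by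
    refine le_antisymm (Finset.sup'_le _ _ fun i _ => ?_) ?_
    · have : u i ≤ 1 := hg ⟨i, rfl⟩
      rw [h]
      nlinarith
    · exact Eq.trans_le (by simp [h, hi₁]) (Finset.le_sup' z (Finset.mem_univ i₁))
  ext i
  rw [stretch, h₀, h₁, h, add_sub_cancel_right, add_sub_cancel_right, mul_div_cancel_left₀ _ hs.ne']

theorem one_sub_mem_spanningVectors {d : ℕ} {u : Fin d → ℝ} (hu : u ∈ spanningVectors d) :
    1 - u ∈ spanningVectors d := by
  obtain ⟨⟨⟨i₀, hi₀⟩, hl⟩, ⟨⟨i₁, hi₁⟩, hg⟩⟩ := hu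
  refine ⟨⟨⟨i₁, by simp [hi₁]⟩, ?_⟩, ⟨⟨i₀, by simp [hi₀]⟩, ?_⟩⟩
  · rintro _ ⟨i, rfl⟩
    have : u i ≤ 1 := hg ⟨i, rfl⟩
    simpa using this
  · rintro _ ⟨i, rfl⟩
    have : 0 ≤ u i := hl ⟨i, rfl⟩
    simpa using this

/-- The spanning vector of a point of the sphere in `ℝ^k`, which is regarded as the quotient of
`ℝ^{k+1}` by the constant vectors, with representatives those of first coordinate `0`. -/
noncomputable def sphereVector {k : ℕ} (x : unitSphere k) : Fin (k + 1) → ℝ :=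
  stretch (Fin.cons 0 x.1.ofLp)

theorem exists_cons_ne {k : ℕ} (x : unitSphere k) :
    ∃ i, (Fin.cons 0 x.1.ofLp : Fin (k + 1) → ℝ) i ≠
      (Fin.cons 0 x.1.ofLp : Fin (k + 1) → ℝ) 0 := by
  by_contra! h
  have hx : x.1 = 0 := by
    ext i
    simpa using h i.succ
  simpa [hx] using x.2

theorem sphereVector_mem {k : ℕ} (x : unitSphere k) : sphereVector x ∈ spanningVectors (k + 1) :=
  (stretch_spec (exists_cons_ne x)).1

theorem continuous_sphereVector {k : ℕ} : Continuous (sphereVector (k := k)) := by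
  have hz : Continuous fun x : unitSphere k => (Fin.cons 0 x.1.ofLp : Fin (k + 1) → ℝ) := by
    refine continuous_pi fun i => ?_
    refine Fin.cases ?_ (fun i => ?_) i
    · exact continuous_const
    · simp only [Fin.cons_succ]
      fun_prop
  have he := fun i => (continuous_apply i).comp hz
  have hinf := Continuous.finset_inf'_apply (s := Finset.univ) Finset.univ_nonempty
    fun i _ => he i
  have hsup := Continuous.finset_sup'_apply (s := Finset.univ) Finset.univ_nonempty
    fun i _ => he i
  exact continuous_pi fun i => ((he i).sub hinf).div (hsup.sub hinf)
    fun x => (sub_pos.2 (inf'_lt_sup'_of_exists_ne (exists_cons_ne x))).ne'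

theorem sphereVector_neg {k : ℕ} (x : unitSphere k) : sphereVector (-x) = 1 - sphereVector x := by
  obtain ⟨hmem, s, t, hs, hst⟩ := stretch_spec (exists_cons_ne x)
  refine stretch_eq (one_sub_mem_spanningVectors hmem) hs (t := -s - t) fun i => ?_
  have hneg : (Fin.cons 0 (-x).1.ofLp : Fin (k + 1) → ℝ) i
      = -(Fin.cons 0 x.1.ofLp : Fin (k + 1) → ℝ) i := by
    refine Fin.cases ?_ (fun i => ?_) i <;> simp
  rw [hneg, hst, Pi.sub_apply, Pi.one_apply, sphereVector]
  ring

theorem sphereVector_injective {k : ℕ} : Function.Injective (sphereVector (k := k)) := by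
  intro x y hxy
  obtain ⟨-, s, t, hs, hst⟩ := stretch_spec (exists_cons_ne x)
  obtain ⟨-, s', t', hs', hst'⟩ := stretch_spec (exists_cons_ne y)
  change stretch _ = stretch _ at hxy
  rw [← hxy] at hst'
  have hprop : s' • x.1 = s • y.1 := by
    ext i
    have e₀ := hst 0
    have e₁ := hst i.succ
    have e₀' := hst' 0
    have e₁' := hst' i.succ
    simp only [Fin.cons_zero, Fin.cons_succ] at e₀ e₁ e₀' e₁'
    simp only [PiLp.smul_apply, smul_eq_mul]
    linear_combination s' * e₁ - s' * e₀ - s * e₁' + s * e₀'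
  have hnorm := congrArg norm hprop
  rw [norm_smul, norm_smul, norm_eq_of_mem_sphere, norm_eq_of_mem_sphere, mul_one, mul_one,
    Real.norm_of_nonneg hs.le, Real.norm_of_nonneg hs'.le] at hnorm
  rw [hnorm] at hprop
  exact Subtype.ext (smul_right_injective _ hs.ne' hprop)

theorem exists_sphereVector_eq {k : ℕ} {u : Fin (k + 1) → ℝ} (hu : u ∈ spanningVectors (k + 1)) :
    ∃ x : unitSphere k, sphereVector x = u := by
  let w : EuclideanSpace ℝ (Fin k) := WithLp.toLp 2 fun i => u i.succ - u 0
  have hw : w ≠ 0 := by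
    intro h0
    have hc : ∀ i, u i = u 0 := by
      refine fun i => Fin.cases rfl (fun i => ?_) i
      exact sub_eq_zero.1 (congrFun (congrArg WithLp.ofLp h0) i)
    obtain ⟨⟨⟨i₀, hi₀⟩, -⟩, ⟨⟨i₁, hi₁⟩, -⟩⟩ := hu
    rw [hc] at hi₀ hi₁
    linarith
  have hpos : 0 < ‖w‖ := norm_pos_iff.2 hw
  refine ⟨⟨‖w‖⁻¹ • w, by simp [norm_smul, hpos.ne']⟩, ?_⟩
  refine stretch_eq hu (inv_pos.2 hpos) (t := -(‖w‖⁻¹ * u 0)) fun i => ?_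
  refine Fin.cases ?_ (fun i => ?_) i
  · simp
  · simp only [Fin.cons_succ, PiLp.smul_apply, smul_eq_mul, w]
    ring

/-! ### The homeomorphism -/

theorem normalForm_minMatrix_mem {k m : ℕ} {u : Fin (k + 1) → ℝ} {v : Fin (m + 1) → ℝ}
    (h : ∃ i i' j j', crossDiff (minMatrix u v) i i' j j' ≠ 0) :
    normalForm (minMatrix u v) ∈ barvinokSpace (k + 1) (m + 1) := by
  have hN := isNormalized_normalForm h
  refine ⟨(hN.barvinokRank_eq_two_iff m.succ_pos).2 ?_, hN⟩
  set c := (rowNormalNorm (minMatrix u v))⁻¹ with hc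
  have hc0 : 0 ≤ c := (inv_pos.2 (rowNormalNorm_pos h)).le
  let r : Fin (k + 1) → ℝ := fun i => Finset.univ.inf' Finset.univ_nonempty fun j' =>
    minMatrix u v i j' - minMatrix u v 0 j'
  let s : Fin (m + 1) → ℝ := fun j => minMatrix u v 0 j
  refine ⟨fun i => c * u i - c * r i, fun i => -(c * r i), fun j => -(c * s j),
    fun j => c * v j - c * s j, fun i j => ?_⟩
  have e : normalForm (minMatrix u v) i j = c * min (u i) (v j) - c * s j - c * r i := by
    simp only [normalForm, rowNormal, ← hc, mul_sub]
    rfl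
  rw [e, mul_min_of_nonneg _ _ hc0, ← min_sub_sub_right, ← min_sub_sub_right]
  congr 1
  ring

theorem exists_crossDiff_sphereVector_ne_zero {k m : ℕ} (p : unitSphere k × unitSphere m) :
    ∃ i i' j j', crossDiff (minMatrix (sphereVector p.1) (sphereVector p.2)) i i' j j' ≠ 0 := by
  obtain ⟨i, i', j, j', -, h⟩ :=
    exists_crossDiff_minMatrix_eq_one (sphereVector_mem p.1) (sphereVector_mem p.2)
  exact ⟨i, i', j, j', h ▸ one_ne_zero⟩

/-- The normalized matrix of minima of the spanning vectors of a pair of points of spheres. -/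
noncomputable def sphereMatrix {k m : ℕ} (p : unitSphere k × unitSphere m) :
    barvinokSpace (k + 1) (m + 1) :=
  ⟨normalForm (minMatrix (sphereVector p.1) (sphereVector p.2)),
    normalForm_minMatrix_mem (exists_crossDiff_sphereVector_ne_zero p)⟩

theorem continuous_sphereMatrix {k m : ℕ} : Continuous (sphereMatrix (k := k) (m := m)) := by
  have hA : Continuous fun p : unitSphere k × unitSphere m =>
      minMatrix (sphereVector p.1) (sphereVector p.2) :=
    continuous_matrix fun i j =>
      ((continuous_apply i).comp (continuous_sphereVector.comp continuous_fst)).min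
        ((continuous_apply j).comp (continuous_sphereVector.comp continuous_snd))
  refine Continuous.subtype_mk (continuous_matrix fun i j => ?_) _
  exact ((continuous_rowNormalNorm.comp hA).inv₀ fun p =>
    (rowNormalNorm_pos (exists_crossDiff_sphereVector_ne_zero p)).ne').mul
      ((continuous_rowNormal.comp hA).matrix_elem i j)

theorem sphereMatrix_eq_iff {k m : ℕ} (p q : unitSphere k × unitSphere m) :
    sphereMatrix p = sphereMatrix q ↔ (antipodalSetoid k m).r p q := by
  constructor
  · intro h
    have hcd : ∀ i i' j j', crossDiff (minMatrix (sphereVector q.1) (sphereVector q.2)) i i' j j' =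
        rowNormalNorm (minMatrix (sphereVector q.1) (sphereVector q.2)) *
          (rowNormalNorm (minMatrix (sphereVector p.1) (sphereVector p.2)))⁻¹ *
          crossDiff (minMatrix (sphereVector p.1) (sphereVector p.2)) i i' j j' := by
      intro i i' j j'
      have hq := rowNormalNorm_pos (exists_crossDiff_sphereVector_ne_zero q)
      have e := congrArg (fun M => crossDiff M i i' j j') (congrArg Subtype.val h)
      simp only [sphereMatrix, crossDiff_normalForm] at e
      rw [mul_assoc, e, mul_inv_cancel_left₀ hq.ne']
    have hpos := mul_pos (rowNormalNorm_pos (exists_crossDiff_sphereVector_ne_zero q))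
      (inv_pos.2 (rowNormalNorm_pos (exists_crossDiff_sphereVector_ne_zero p)))
    rcases eq_or_eq_one_sub_of_crossDiff (sphereVector_mem p.1) (sphereVector_mem p.2)
      (sphereVector_mem q.1) (sphereVector_mem q.2) hpos hcd with ⟨h₁, h₂⟩ | ⟨h₁, h₂⟩
    · exact Or.inl (Prod.ext (sphereVector_injective h₁) (sphereVector_injective h₂))
    · rw [← sphereVector_neg] at h₁ h₂
      exact Or.inr (Prod.ext (sphereVector_injective h₁) (sphereVector_injective h₂))
  · rintro (rfl | rfl)
    · rfl
    · have hp := rowNormalNorm_pos (exists_crossDiff_sphereVector_ne_zero p)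
      have hq := rowNormalNorm_pos (exists_crossDiff_sphereVector_ne_zero (-p.1, -p.2))
      refine Subtype.ext (IsNormalized.eq_of_crossDiff (sphereMatrix p).2.2
        (sphereMatrix (-p.1, -p.2)).2.2 (mul_pos (inv_pos.2 hp) hq) fun i i' j j' => ?_)
      simp only [sphereMatrix, crossDiff_normalForm]
      rw [mul_assoc, mul_inv_cancel_left₀ hq.ne']
      simp only [sphereVector_neg, crossDiff_minMatrix_one_sub]

theorem sphereMatrix_surjective {k m : ℕ} :
    Function.Surjective (sphereMatrix (k := k) (m := m)) := by
  rintro ⟨M, hM⟩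
  have hN : IsNormalized M := hM.2
  obtain ⟨p, q, a, b, hpq⟩ := (hN.barvinokRank_eq_two_iff m.succ_pos).1 hM.1
  -- adding `p i + b j` to the entries of this matrix of minima gives `M`
  have hcd : ∀ i i' j j', crossDiff M i i' j j' = crossDiff (minMatrix (q - p) (a - b)) i i' j j' := by
    have e : ∀ i j, M i j = min ((q - p) i) ((a - b) j) + (p i + b j) := by
      intro i j
      rw [hpq, ← min_add_add_right, min_comm]
      simp only [Pi.sub_apply]
      congr 1 <;> ring
    intro i i' j j'
    simp only [crossDiff, e, minMatrix]
    ring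
  obtain ⟨u, hu, v, hv, c, hc, huv⟩ := exists_spanningVectors (q - p) (a - b)
    (by simpa only [hcd] using hN.exists_crossDiff_ne_zero)
  obtain ⟨x, rfl⟩ := exists_sphereVector_eq hu
  obtain ⟨y, rfl⟩ := exists_sphereVector_eq hv
  have hpos := rowNormalNorm_pos (exists_crossDiff_sphereVector_ne_zero (x, y))
  refine ⟨(x, y), Subtype.ext (IsNormalized.eq_of_crossDiff (sphereMatrix (x, y)).2.2 hN
    (mul_pos (inv_pos.2 hpos) (inv_pos.2 hc)) fun i i' j j' => ?_)⟩
  simp only [sphereMatrix, crossDiff_normalForm]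
  rw [hcd, huv, mul_assoc, inv_mul_cancel_left₀ hc.ne']

theorem theorem1 (d n : ℕ) (hd : 0 < d) (hn : 0 < n) :
    Nonempty (barvinokSpace d n ≃ₜ Quotient (antipodalSetoid (d - 1) (n - 1))) := by
  obtain ⟨k, rfl⟩ := Nat.exists_eq_succ_of_ne_zero hd.ne'
  obtain ⟨m, rfl⟩ := Nat.exists_eq_succ_of_ne_zero hn.ne'
  change Nonempty (barvinokSpace (k + 1) (m + 1) ≃ₜ Quotient (antipodalSetoid k m))
  let f : Quotient (antipodalSetoid k m) → barvinokSpace (k + 1) (m + 1) :=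
    Quotient.lift sphereMatrix fun p q h => (sphereMatrix_eq_iff p q).2 h
  have hf : Continuous f := continuous_sphereMatrix.quotient_lift _
  have hbij : Function.Bijective f := by
    refine ⟨?_, fun M => ?_⟩
    · rintro ⟨p⟩ ⟨q⟩ h
      exact Quotient.sound ((sphereMatrix_eq_iff p q).1 h)
    · obtain ⟨p, hp⟩ := sphereMatrix_surjective M
      exact ⟨Quotient.mk _ p, hp⟩
  -- a continuous bijection from a compact space to a Hausdorff space
  exact ⟨(Continuous.homeoOfEquivCompactToT2 (f := Equiv.ofBijective f hbij) hf).symm⟩
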